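/- Let $X$ be a nonzero Banach space over $\mathbb{R}$ or $\mathbb{C}$, with dual space $X^*$. A sequence $(x_i,f_i)_{i\ge 1}$ in $X\times X^*$ is called a Schauder frame of $X$ if $x_i\neq 0$ for all $i$ and $x=\sum_{i=1}^\infty f_i(x)\,x_i$ in norm for every $x\in X$ (the series being summed in the given order). It is called shrinking if moreover $f=\sum_{i=1}^\infty f(x_i)\,f_i$ in the norm of $X^*$ for every $f\in X^*$. A Banach space $E$ has the bounded approximation property if there is a constant $\lambda$ such that for every compact set $K\subseteq E$ and every $\varepsilon>0$ there is a bounded finite rank operator $T:E\to E$ with $\|T\|\le\lambda$ and $\|v-Tv\|\le\varepsilon$ for all $v\in K$. Then $X$ has a shrinking Schauder frame if and only if $X^*$ is separable and has the bounded approximation property. -/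

import Mathlib

open Filter Topology

/-- The pairs `(x i, f i)` in `E × E*` reconstruct `E`: for every `v` in `E` the series
`∑ f i (v) x i`, summed in its given order, converges in norm to `v`. -/
def Reconstructs (𝕜 : Type*) [RCLike 𝕜] {E : Type*} [NormedAddCommGroup E] [NormedSpace 𝕜 E]
    (x : ℕ → E) (f : ℕ → StrongDual 𝕜 E) : Prop :=
  ∀ v : E, Tendsto (fun n : ℕ => ∑ i ∈ Finset.range n, f i v • x i) atTop (𝓝 v)

/-- A Schauder frame: a reconstructing sequence of pairs, with all vectors `x i` nonzero. -/
structure IsSchauderFrame (𝕜 : Type*) [RCLike 𝕜] {E : Type*} [NormedAddCommGroup E]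
    [NormedSpace 𝕜 E] (x : ℕ → E) (f : ℕ → StrongDual 𝕜 E) : Prop where
  ne_zero : ∀ i, x i ≠ 0
  reconstructs : Reconstructs 𝕜 x f

/-- A Schauder frame `(x i, f i)` of `E` is shrinking if the pairs `(f i, x i)`, with `x i` seen in
the bidual, reconstruct the dual with its norm: `g = ∑ g (x i) f i` for all `g` in `E*`.
The convention that vectors be nonzero is made for the `x i` only; some `f i` may vanish. -/
structure IsShrinkingSchauderFrame (𝕜 : Type*) [RCLike 𝕜] {E : Type*} [NormedAddCommGroup E]
    [NormedSpace 𝕜 E] (x : ℕ → E) (f : ℕ → StrongDual 𝕜 E) : Prop where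
  isSchauderFrame : IsSchauderFrame 𝕜 x f
  reconstructs_dual :
    Reconstructs 𝕜 f (fun i => NormedSpace.inclusionInDoubleDual 𝕜 E (x i))

/-- The bounded approximation property: for some constant `c`, the identity is approximated
uniformly on every compact set by finite rank operators of norm at most `c`. -/
def HasBAP (𝕜 : Type*) [RCLike 𝕜] (E : Type*) [NormedAddCommGroup E] [NormedSpace 𝕜 E] : Prop :=
  ∃ c : ℝ, ∀ K : Set E, IsCompact K → ∀ ε : ℝ, 0 < ε →
    ∃ T : E →L[𝕜] E, FiniteDimensional 𝕜 (LinearMap.range (T : E →ₗ[𝕜] E)) ∧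
      ‖T‖ ≤ c ∧ ∀ v ∈ K, ‖v - T v‖ ≤ ε

/-! A reconstructing sequence of `X*` has finite rank partial sums converging strongly to the
identity. Banach-Steinhaus bounds them, convergence is then uniform on compact sets, and the span of
the reconstructing vectors is dense.

Conversely, a finite rank operator R = ∑ φ_j ⊗ g_j on `X*` has its φ_j in the bidual, so it need not
be an adjoint. A Helly argument (`exists_norm_sub_lt_of_bidual`) replaces the φ_j by vectors x_j of
X; the adjoint of T = ∑ g_j ⊗ x_j is close to R on a finite set, at bounded cost in norm
(`exists_finiteRankOps_comp_sub_le`). Such T are weakly close to the identity of X, so by Mazur's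
convexity argument some are strongly close (`exists_finiteRankOps_norm_sub_le`). Separability turns
this into a sequence S_n.

Each S_{n+1} - S_n is then written as a sum of rank one operators. Dividing the terms by a large m
and running through them m times keeps all partial sums near t(S_{n+1} - S_n) with |t| ≤ 1, however
badly the original splitting behaves. The concatenated terms form the frame. -/

/-! ### Hahn-Banach separation and a Helly type theorem -/

/-- A nearly norming vector for a functional, in a ball of prescribed radius. -/
theorem StrongDual.exists_norm_lt_le_re {𝕜 Y : Type*} [RCLike 𝕜] [NormedAddCommGroup Y]
    [NormedSpace 𝕜 Y] (h : StrongDual 𝕜 Y) {s r : ℝ} (hr : 0 < r) (hs : s < r) :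
    ∃ w : Y, ‖w‖ < r ∧ s * ‖h‖ ≤ RCLike.re (h w) := by
  rcases eq_or_ne h 0 with rfl | hh
  · exact ⟨0, by simpa using hr, by simp⟩
  have hpos : 0 < ‖h‖ := norm_pos_iff.2 hh
  have h1 : s / r * ‖h‖ < ‖h‖ := by
    have : s / r < 1 := (div_lt_one hr).2 hs
    nlinarith
  obtain ⟨y, hy, hlt⟩ := h.exists_lt_apply_of_lt_opNorm h1
  obtain ⟨c, hc, hc'⟩ := RCLike.exists_norm_eq_mul_self (h y)
  refine ⟨((r : 𝕜) * c) • y, ?_, ?_⟩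
  · rw [norm_smul, norm_mul, hc, mul_one, RCLike.norm_ofReal, abs_of_pos hr]
    nlinarith
  · rw [map_smul, smul_eq_mul, mul_assoc, ← hc', ← RCLike.ofReal_mul, RCLike.ofReal_re]
    have : s * ‖h‖ = r * (s / r * ‖h‖) := by field_simp
    rw [this]
    gcongr

/-- A functional whose real part is bounded below on a subspace vanishes there. -/
theorem StrongDual.eq_zero_of_forall_le_re {𝕜 Y : Type*} [RCLike 𝕜] [NormedAddCommGroup Y]
    [NormedSpace 𝕜 Y] (f : StrongDual 𝕜 Y) {p : Submodule 𝕜 Y} {u : ℝ}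
    (hf : ∀ y ∈ p, u ≤ RCLike.re (f y)) {y : Y} (hy : y ∈ p) : f y = 0 := by
  by_contra hne
  have hn : 0 < ‖f y‖ := norm_pos_iff.2 hne
  obtain ⟨c, hc, hc'⟩ := RCLike.exists_norm_eq_mul_self (f y)
  -- This multiple of y has image u - 1, below the assumed bound.
  have := hf _ (p.smul_mem (((u - 1) / ‖f y‖ : ℝ) : 𝕜) (p.smul_mem c hy))
  rw [f.map_smul, f.map_smul, smul_eq_mul, smul_eq_mul, ← hc',
    ← RCLike.ofReal_mul, RCLike.ofReal_re, div_mul_cancel₀ _ hn.ne'] at this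
  linarith

/-- A Helly type theorem: if an element `Φ` of the bidual of `E` approximately solves finitely many
norm constraints, then so does some element of `E`. -/
theorem exists_norm_sub_lt_of_bidual {𝕜 E Y κ : Type*} [RCLike 𝕜] [NormedAddCommGroup E]
    [NormedSpace 𝕜 E] [NormedAddCommGroup Y] [NormedSpace 𝕜 Y] [Fintype κ]
    (Φ : StrongDual 𝕜 (StrongDual 𝕜 E)) (A : κ → E →L[𝕜] Y) (z : κ → Y) (r s : κ → ℝ)
    (hr : ∀ k, 0 < r k) (hs : ∀ k, s k < r k)
    (hΦ : ∀ k (h : StrongDual 𝕜 Y), ‖Φ (h.comp (A k)) - h (z k)‖ ≤ s k * ‖h‖) :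
    ∃ x : E, ∀ k, ‖A k x - z k‖ < r k := by
  classical
  by_contra! hcon
  let _ : NormedSpace ℝ Y := NormedSpace.restrictScalars ℝ 𝕜 Y
  have : IsScalarTower ℝ 𝕜 Y := RestrictScalars.isScalarTower ℝ 𝕜 Y
  let _ : NormedSpace ℝ E := NormedSpace.restrictScalars ℝ 𝕜 E
  have : IsScalarTower ℝ 𝕜 E := RestrictScalars.isScalarTower ℝ 𝕜 E
  let L : E →L[𝕜] (κ → Y) := ContinuousLinearMap.pi A
  -- The constraints are solvable exactly when the range of `L` meets this product of balls;
  -- otherwise the two are separated.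
  let U : Set (κ → Y) := Set.univ.pi fun k => Metric.ball (z k) (r k)
  have hUc : Convex ℝ U := convex_pi fun k _ => convex_ball _ _
  have hUo : IsOpen U := isOpen_set_pi Set.finite_univ fun k _ => Metric.isOpen_ball
  have hVc : Convex ℝ (Set.range L) := by
    rw [← Set.image_univ]
    exact convex_univ.is_linear_image (f := L)
      ⟨fun x y => map_add L x y, fun c x => (L.restrictScalars ℝ).map_smul c x⟩
  have hdisj : Disjoint U (Set.range L) := by
    rw [Set.disjoint_left]
    rintro _ hx ⟨x, rfl⟩
    obtain ⟨k, hk⟩ := hcon x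
    have := hx k (Set.mem_univ k)
    rw [Metric.mem_ball, dist_eq_norm] at this
    exact absurd this (not_lt.2 hk)
  obtain ⟨Λ, u, hΛU, hΛV⟩ := RCLike.geometric_hahn_banach_open (𝕜 := 𝕜) hUc hUo hVc hdisj
  have hu : u ≤ 0 := by simpa using hΛV 0 ⟨0, by simp⟩
  have hL : Λ.comp L = 0 := by
    ext x
    exact Λ.eq_zero_of_forall_le_re (p := LinearMap.range (L : E →ₗ[𝕜] (κ → Y))) hΛV ⟨x, rfl⟩
  let h : κ → StrongDual 𝕜 Y := fun k => Λ.comp (ContinuousLinearMap.single 𝕜 (fun _ => Y) k)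
  have hΛ : ∀ v, Λ v = ∑ k, h k (v k) := fun v =>
    (ContinuousLinearMap.sum_comp_single 𝕜 (fun _ : κ => Y) Λ v).symm
  have hsum : ∑ k, (h k).comp (A k) = 0 := by
    rw [← hL]
    ext x
    simp [hΛ, L]
  have hΦ0 : ∑ k, Φ ((h k).comp (A k)) = 0 := by rw [← map_sum, hsum, map_zero]
  -- Moving from z by w stays in `U`, yet raises the real part of each h_k by at least |Φ(h_k ∘ A_k)
  -- - h_k(z_k)|. As the Φ(h_k ∘ A_k) sum to 0, the value of `Λ` at z + w cannot be negative.
  choose w hw hw' using fun k => (h k).exists_norm_lt_le_re (hr k) (hs k)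
  have hmem : z + w ∈ U := fun k _ => by simpa using hw k
  have h1 := hΛU _ hmem
  have h2 : RCLike.re (Λ (z + w)) =
      ∑ k, (RCLike.re (h k (w k)) - RCLike.re (Φ ((h k).comp (A k)) - h k (z k))) := by
    have : (∑ k, RCLike.re (Φ ((h k).comp (A k)))) = 0 := by rw [← map_sum, hΦ0, map_zero]
    simp only [hΛ, map_sum, Pi.add_apply, map_add, map_sub, Finset.sum_sub_distrib,
      Finset.sum_add_distrib, this]
    ring
  have h3 : 0 ≤ RCLike.re (Λ (z + w)) := by
    rw [h2]
    refine Finset.sum_nonneg fun k _ => sub_nonneg.2 ?_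
    exact ((RCLike.re_le_norm _).trans (hΦ k (h k))).trans (hw' k)
  linarith

/-! ### Concatenated and repeated lists -/

/-- Prefixes of an infinite concatenation of nonempty lists. -/
theorem List.exists_infinite_flatten {α : Type*} (L : ℕ → List α) (hL : ∀ n, L n ≠ []) :
    ∃ u : ℕ → α, (∀ i, ∃ n, u i ∈ L n) ∧ ∀ M, ∃ K, ∀ k, K ≤ k → ∃ N, M ≤ N ∧ ∃ j,
      (List.range k).map u = ((List.range N).map L).flatten ++ (L N).take j := by
  let P : ℕ → List α := fun N => ((List.range N).map L).flatten
  have hP : ∀ N, P (N + 1) = P N ++ L N := fun N => by simp [P, List.range_succ]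
  have hlen : ∀ N, (P N).length < (P (N + 1)).length := fun N => by
    rw [hP, List.length_append]
    have := List.length_pos_iff.2 (hL N)
    omega
  have hmono : StrictMono fun N => (P N).length := strictMono_nat_of_lt_succ hlen
  have hid : ∀ N, N ≤ (P N).length := fun N => hmono.le_apply
  have hpre : ∀ M N, M ≤ N → P M <+: P N := fun M N h => by
    induction N, h using Nat.le_induction with
    | base => exact List.prefix_refl _
    | succ N _ ih => exact ih.trans (by rw [hP]; exact List.prefix_append _ _)
  let u : ℕ → α := fun i => (P (i + 1))[i]'(hid (i + 1))
  have hu : ∀ i N (h : i < (P N).length), u i = (P N)[i] := fun i N h => by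
    rcases le_total (i + 1) N with hle | hle
    · exact (hpre _ _ hle).getElem _
    · exact ((hpre _ _ hle).getElem _).symm
  refine ⟨u, fun i => ?_, fun M => ⟨(P M).length, fun k hk => ?_⟩⟩
  · have : u i ∈ P (i + 1) := List.getElem_mem _
    simp only [P, List.mem_flatten, List.mem_map] at this
    obtain ⟨_, ⟨n, _, rfl⟩, h⟩ := this
    exact ⟨n, h⟩
  · have hex : ∃ N, k < (P (N + 1)).length := ⟨k, hid (k + 1)⟩
    classical
    -- The block containing position k.
    let N := Nat.find hex
    have hN : k < (P (N + 1)).length := Nat.find_spec hex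
    have hMN : M ≤ N := by
      by_contra! hlt
      have := hmono.monotone (show N + 1 ≤ M from hlt)
      omega
    have hN' : (P N).length ≤ k := by
      rcases Nat.eq_zero_or_pos N with h0 | h0
      · simp [h0, P]
      · have := Nat.find_min hex (show N - 1 < N by omega)
        rw [Nat.sub_add_cancel h0] at this
        omega
    refine ⟨N, hMN, k - (P N).length, ?_⟩
    have h1 : (List.range k).map u = (P (N + 1)).take k := by
      apply List.ext_getElem
      · simp; omega
      · intro i h1 h2
        simp only [List.length_map, List.length_range] at h1
        simp only [List.getElem_map, List.getElem_range, List.getElem_take]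
        exact hu i _ _
    rw [h1, hP, List.take_append, List.take_of_length_le hN']

/-- A prefix consists of j whole copies and a prefix of one more; only the latter contributes to the
error. -/
theorem List.exists_sum_take_flatten_replicate {G : Type*} [NormedAddCommGroup G] (l : List G)
    {M : ℝ} (hM : ∀ k, ‖(l.take k).sum‖ ≤ M) (m k : ℕ) :
    ∃ j ≤ m, ‖((List.replicate m l).flatten.take k).sum - j • l.sum‖ ≤ M := by
  induction m generalizing k with
  | zero => exact ⟨0, le_rfl, by simpa using (norm_nonneg _).trans (hM 0)⟩
  | succ m ih =>
    rw [List.replicate_succ, List.flatten_cons, List.take_append]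
    rcases le_total k l.length with hk | hk
    · exact ⟨0, Nat.zero_le _, by simpa [Nat.sub_eq_zero_of_le hk] using hM k⟩
    · obtain ⟨j, hj, hle⟩ := ih (k - l.length)
      refine ⟨j + 1, by omega, ?_⟩
      rw [List.take_of_length_le hk, List.sum_append, add_smul, one_smul]
      convert hle using 2
      abel

/-! ### Rank one decompositions and interpolation -/

section

variable {𝕜 X : Type*} [RCLike 𝕜] [NormedAddCommGroup X] [NormedSpace 𝕜 X]

/-- The rank one operator `f ⊗ x` given by a pair `(x, f)`. -/
noncomputable def rankOneOp (p : X × StrongDual 𝕜 X) : X →L[𝕜] X := p.2.smulRight p.1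

variable (𝕜 X) in
/-- The space of bounded finite rank operators. -/
noncomputable def finiteRankOps : Submodule 𝕜 (X →L[𝕜] X) :=
  Submodule.span 𝕜 (Set.range rankOneOp)

/-- Putting the scalar into the functional keeps the vector nonzero, even for c = 0. -/
theorem smul_rankOneOp (c : 𝕜) (p : X × StrongDual 𝕜 X) :
    c • rankOneOp p = rankOneOp (p.1, c • p.2) := by
  ext v
  simp [rankOneOp, mul_smul]

theorem exists_list_sum_rankOneOp {T : X →L[𝕜] X} (hT : T ∈ finiteRankOps 𝕜 X) :
    ∃ l : List (X × StrongDual 𝕜 X), (∀ p ∈ l, p.1 ≠ 0) ∧ (l.map rankOneOp).sum = T := by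
  induction hT using Submodule.span_induction with
  | mem T hT =>
    obtain ⟨p, rfl⟩ := hT
    by_cases hp : p.1 = 0
    · exact ⟨[], by simp, by ext; simp [rankOneOp, hp]⟩
    · exact ⟨[p], by simpa using hp, by simp⟩
  | zero => exact ⟨[], by simp, by simp⟩
  | add T₁ T₂ _ _ h₁ h₂ =>
    obtain ⟨l₁, h₁, rfl⟩ := h₁
    obtain ⟨l₂, h₂, rfl⟩ := h₂
    exact ⟨l₁ ++ l₂, fun p hp => (List.mem_append.1 hp).elim (h₁ p) (h₂ p), by simp⟩
  | smul c T _ h =>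
    obtain ⟨l, h, rfl⟩ := h
    refine ⟨l.map fun p => (p.1, c • p.2), fun p hp => ?_, ?_⟩
    · obtain ⟨q, hq, rfl⟩ := List.mem_map.1 hp
      exact h q hq
    · rw [List.smul_sum, List.map_map, List.map_map]
      congr 2
      ext1 p
      exact (smul_rankOneOp c p).symm

/-- A finite rank operator is a sum of rank one operators whose partial sums are close to multiples
of the operator. -/
theorem exists_list_sum_rankOneOp_take [Nontrivial X] {T : X →L[𝕜] X}
    (hT : T ∈ finiteRankOps 𝕜 X) {δ : ℝ} (hδ : 0 < δ) :
    ∃ l : List (X × StrongDual 𝕜 X), l ≠ [] ∧ (∀ p ∈ l, p.1 ≠ 0) ∧ (l.map rankOneOp).sum = T ∧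
      ∀ k, ∃ t : 𝕜, ‖t‖ ≤ 1 ∧ ‖((l.map rankOneOp).take k).sum - t • T‖ ≤ δ := by
  obtain ⟨l₀, hl₀, hsum₀⟩ := exists_list_sum_rankOneOp hT
  obtain ⟨e, he⟩ := exists_ne (0 : X)
  obtain ⟨l₁, hne, hl₁, hsum₁⟩ : ∃ l : List (X × StrongDual 𝕜 X), l ≠ [] ∧ (∀ p ∈ l, p.1 ≠ 0) ∧
      (l.map rankOneOp).sum = T := by
    -- A null term with nonzero vector makes the list nonempty, as concatenation requires.
    refine ⟨(e, 0) :: l₀, by simp, ?_, ?_⟩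
    · intro p hp
      rcases List.mem_cons.1 hp with rfl | hp
      · exact he
      · exact hl₀ p hp
    · rw [List.map_cons, List.sum_cons, hsum₀, add_eq_right]
      ext
      simp [rankOneOp]
  obtain ⟨M, hM⟩ : ∃ M : ℝ, ∀ k, ‖((l₁.map rankOneOp).take k).sum‖ ≤ M := by
    refine ⟨((l₁.map rankOneOp).map norm).sum, fun k => ?_⟩
    have hle : ∀ l : List (X →L[𝕜] X), ‖l.sum‖ ≤ (l.map norm).sum :=
      fun l => List.le_sum_of_subadditive norm norm_zero.le norm_add_le l
    refine (hle _).trans ?_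
    refine List.Sublist.sum_le_sum (List.Sublist.map _ (List.take_sublist _ _)) ?_
    intro a ha
    obtain ⟨b, -, rfl⟩ := List.mem_map.1 ha
    exact norm_nonneg _
  -- After division by m, one pass has partial sums of norm at most M / m < δ, and j full passes
  -- give (j / m) T.
  obtain ⟨m, hm⟩ := exists_nat_gt (M / δ)
  have hM0 : 0 ≤ M := (norm_nonneg _).trans (hM 0)
  have hm0 : (0 : ℝ) < m := (div_nonneg hM0 hδ.le).trans_lt hm
  have hmk : (m : 𝕜) ≠ 0 := by
    have : m ≠ 0 := by rintro rfl; simp at hm0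
    exact_mod_cast this
  let l₂ : List (X × StrongDual 𝕜 X) := l₁.map fun p => (p.1, (m : 𝕜)⁻¹ • p.2)
  have hmap : l₂.map rankOneOp = (l₁.map rankOneOp).map ((m : 𝕜)⁻¹ • ·) := by
    simp only [l₂, List.map_map]
    congr 1
    ext1 p
    exact (smul_rankOneOp _ p).symm
  have hsum₂ : (l₂.map rankOneOp).sum = (m : 𝕜)⁻¹ • T := by
    rw [hmap, ← List.smul_sum, hsum₁]
  have hM₂ : ∀ k, ‖((l₂.map rankOneOp).take k).sum‖ ≤ M / m := fun k => by
    rw [hmap, ← List.map_take, ← List.smul_sum, norm_smul, norm_inv, RCLike.norm_natCast,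
      inv_mul_eq_div]
    gcongr
    exact hM k
  have hflat : (List.replicate m l₂).flatten.map rankOneOp =
      (List.replicate m (l₂.map rankOneOp)).flatten := by
    rw [List.map_flatten, List.map_replicate]
  refine ⟨(List.replicate m l₂).flatten, ?_, ?_, ?_, fun k => ?_⟩
  · intro h
    rw [List.flatten_eq_nil_iff] at h
    have : l₂ = [] := h l₂ (List.mem_replicate.2 ⟨by rintro rfl; simp at hm0, rfl⟩)
    simp [l₂, hne] at this
  · intro p hp
    obtain ⟨l, hl, hp⟩ := List.mem_flatten.1 hp
    rw [(List.mem_replicate.1 hl).2] at hp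
    obtain ⟨q, hq, rfl⟩ := List.mem_map.1 hp
    exact hl₁ q hq
  · rw [hflat, List.sum_flatten, List.map_replicate, List.sum_replicate, hsum₂,
      ← Nat.cast_smul_eq_nsmul 𝕜, smul_smul, mul_inv_cancel₀ hmk, one_smul]
  · obtain ⟨j, hj, hle⟩ := List.exists_sum_take_flatten_replicate _ hM₂ m k
    refine ⟨(j : 𝕜) * (m : 𝕜)⁻¹, ?_, ?_⟩
    · rw [norm_mul, norm_inv, RCLike.norm_natCast, RCLike.norm_natCast, ← div_eq_mul_inv]
      exact div_le_one_of_le₀ (by exact_mod_cast hj) hm0.le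
    · rw [hsum₂, ← Nat.cast_smul_eq_nsmul 𝕜, smul_smul] at hle
      rw [hflat]
      refine hle.trans ?_
      rw [div_lt_iff₀ hδ] at hm
      rw [div_le_iff₀ hm0]
      linarith

/-- Finite rank operators `S n` can be interpolated by the partial sums of a series of rank one
operators. -/
theorem exists_seq_rankOneOp_interpolating [Nontrivial X] {S : ℕ → X →L[𝕜] X} (hS₀ : S 0 = 0)
    (hS : ∀ n, S n ∈ finiteRankOps 𝕜 X) :
    ∃ u : ℕ → X × StrongDual 𝕜 X, (∀ i, (u i).1 ≠ 0) ∧ ∀ M, ∃ K, ∀ k, K ≤ k → ∃ N, M ≤ N ∧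
      ∃ t : 𝕜, ‖t‖ ≤ 1 ∧ ‖∑ i ∈ Finset.range k, rankOneOp (u i) - S N - t • (S (N + 1) - S N)‖ ≤
        1 / ((N : ℝ) + 1) := by
  choose L hne hL hsum htake using fun n : ℕ =>
    exists_list_sum_rankOneOp_take (sub_mem (hS (n + 1)) (hS n))
      (show (0 : ℝ) < 1 / ((n : ℝ) + 1) by positivity)
  obtain ⟨u, huL, hu⟩ := List.exists_infinite_flatten L hne
  refine ⟨u, fun i => ?_, fun M => ?_⟩
  · obtain ⟨n, hn⟩ := huL i
    exact hL n _ hn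
  have hflat : ∀ N, (((List.range N).map L).flatten.map rankOneOp).sum = S N := fun N => by
    induction N with
    | zero => simp [hS₀]
    | succ N ih =>
      rw [List.range_succ, List.map_append, List.flatten_append, List.map_append, List.sum_append,
        ih]
      simp [hsum]
  obtain ⟨K, hK⟩ := hu M
  refine ⟨K, fun k hk => ?_⟩
  obtain ⟨N, hN, j, hj⟩ := hK k hk
  obtain ⟨t, ht, hle⟩ := htake N j
  have hsumk : ∑ i ∈ Finset.range k, rankOneOp (u i) =
      S N + (((L N).map rankOneOp).take j).sum := by
    rw [← hflat, ← List.map_take, ← List.sum_append, ← List.map_append, ← hj, List.map_map]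
    rfl
  refine ⟨N, hN, t, ht, ?_⟩
  rwa [hsumk, add_sub_cancel_left]

/-- Sequences interpolating `S` converge in the same sense as `S`. -/
theorem tendsto_of_interpolating {V F : Type*} [NormedAddCommGroup V] [NormedSpace 𝕜 V]
    [NormedAddCommGroup F] [NormedSpace 𝕜 F] {S P : ℕ → V}
    (hP : ∀ M, ∃ K, ∀ k, K ≤ k → ∃ N, M ≤ N ∧
      ∃ t : 𝕜, ‖t‖ ≤ 1 ∧ ‖P k - S N - t • (S (N + 1) - S N)‖ ≤ 1 / ((N : ℝ) + 1))
    (ev : V →L[𝕜] F) {w : F} (hw : Tendsto (fun n => ev (S n)) atTop (𝓝 w)) :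
    Tendsto (fun k => ev (P k)) atTop (𝓝 w) := by
  have hb : Tendsto (fun N : ℕ => ‖ev (S N) - w‖ + ‖ev (S (N + 1)) - ev (S N)‖ +
      ‖ev‖ * (1 / ((N : ℝ) + 1))) atTop (𝓝 0) := by
    have h1 : Tendsto (fun N => ‖ev (S N) - w‖) atTop (𝓝 0) := tendsto_iff_norm_sub_tendsto_zero.1 hw
    have h2 : Tendsto (fun N => ‖ev (S (N + 1)) - ev (S N)‖) atTop (𝓝 0) := by
      simpa using ((hw.comp (tendsto_add_atTop_nat 1)).sub hw).norm
    simpa using (h1.add h2).add (tendsto_one_div_add_atTop_nhds_zero_nat.const_mul ‖ev‖)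
  rw [Metric.tendsto_atTop]
  intro ε hε
  obtain ⟨M, hM⟩ := eventually_atTop.1 (hb.eventually_lt_const hε)
  obtain ⟨K, hK⟩ := hP M
  refine ⟨K, fun k hk => ?_⟩
  obtain ⟨N, hN, t, ht, hle⟩ := hK k hk
  refine lt_of_le_of_lt ?_ (hM N hN)
  have : ev (P k) - w = (ev (S N) - w) + t • (ev (S (N + 1)) - ev (S N)) +
      ev (P k - S N - t • (S (N + 1) - S N)) := by
    simp only [map_sub, map_smul]
    abel
  rw [dist_eq_norm, this]
  refine norm_add₃_le.trans ?_
  gcongr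
  · rw [norm_smul]
    exact mul_le_of_le_one_left (norm_nonneg _) ht
  · exact ev.le_opNorm_of_le hle

end

/-! ### From operators on the dual to adjoints -/

theorem ContinuousLinearMap.exists_sum_smul_of_finiteDimensional_range {𝕜 E F : Type*} [RCLike 𝕜]
    [NormedAddCommGroup E] [NormedSpace 𝕜 E] [NormedAddCommGroup F] [NormedSpace 𝕜 F]
    (T : E →L[𝕜] F) (hT : FiniteDimensional 𝕜 (LinearMap.range (T : E →ₗ[𝕜] F))) :
    ∃ (n : ℕ) (φ : Fin n → StrongDual 𝕜 E) (y : Fin n → F), ∀ v, T v = ∑ j, φ j v • y j := by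
  let W := LinearMap.range (T : E →ₗ[𝕜] F)
  let b := Module.finBasis 𝕜 W
  let T' : E →L[𝕜] W := T.codRestrict W fun v => ⟨v, rfl⟩
  refine ⟨_, fun j => (LinearMap.toContinuousLinearMap (b.coord j)).comp T', fun j => b j,
    fun v => ?_⟩
  have h := congrArg (Subtype.val : W → F) (b.sum_repr (T' v))
  rw [Submodule.coe_sum] at h
  exact h.symm

section

variable {𝕜 X : Type*} [RCLike 𝕜] [NormedAddCommGroup X] [NormedSpace 𝕜 X]

theorem smulRight_mem_finiteRankOps (g : StrongDual 𝕜 X) (x : X) :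
    g.smulRight x ∈ finiteRankOps 𝕜 X :=
  Submodule.subset_span ⟨(x, g), rfl⟩

/-- Finitely many functionals have a finite net for the unit ball. -/
theorem exists_finset_forall_norm_sub_le {n : ℕ} (g : Fin n → StrongDual 𝕜 X) {η : ℝ}
    (hη : 0 < η) : ∃ t : Finset X, (∀ y ∈ t, ‖y‖ ≤ 1) ∧
      ∀ x : X, ‖x‖ ≤ 1 → ∃ y ∈ t, ∀ j, ‖g j x - g j y‖ ≤ η := by
  classical
  let L : X →L[𝕜] (Fin n → 𝕜) := ContinuousLinearMap.pi g
  have hb : TotallyBounded (L '' Metric.closedBall 0 1) :=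
    ((L.lipschitz.isBounded_image Metric.isBounded_closedBall).isCompact_closure).totallyBounded.subset
      subset_closure
  obtain ⟨s, hs, hfin, hcov⟩ := Metric.finite_approx_of_totallyBounded hb η hη
  obtain ⟨t, ht, rfl⟩ := Set.subset_image_iff.1 hs
  -- One preimage is kept for each of the finitely many centres.
  obtain ⟨t', ht', hfin', himg⟩ := Set.exists_subset_bijOn t L |>.elim fun t' h =>
    (⟨t', h.1, (h.2.finite_iff_finite).2 hfin, h.2.image_eq⟩ :
      ∃ t' ⊆ t, t'.Finite ∧ L '' t' = L '' t)
  refine ⟨hfin'.toFinset, fun y hy => ?_, fun x hx => ?_⟩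
  · simpa using ht (ht' (hfin'.mem_toFinset.1 hy))
  · have hx' := hcov ⟨x, by simpa using hx, rfl⟩
    rw [← himg] at hx'
    simp only [Set.mem_iUnion] at hx'
    obtain ⟨_, ⟨y, hy, rfl⟩, hxy⟩ := hx'
    refine ⟨y, hfin'.mem_toFinset.2 hy, fun j => ?_⟩
    rw [Metric.mem_ball, dist_eq_norm] at hxy
    exact (norm_le_pi_norm (L x - L y) j).trans hxy.le

/-- Finite rank operators of the dual are approximated, on finite sets, by adjoints of finite rank
operators, with control of the norm. -/
theorem exists_finiteRankOps_comp_sub_le [Nontrivial X]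
    (R : StrongDual 𝕜 X →L[𝕜] StrongDual 𝕜 X)
    (hR : FiniteDimensional 𝕜 (LinearMap.range (R : StrongDual 𝕜 X →ₗ[𝕜] StrongDual 𝕜 X)))
    (F : Finset (StrongDual 𝕜 X)) {ε : ℝ} (hε : 0 < ε) :
    ∃ T ∈ finiteRankOps 𝕜 X, ‖T‖ ≤ ‖R‖ + 2 ∧ ∀ f ∈ F, ‖f.comp T - R f‖ ≤ ε := by
  classical
  obtain ⟨n, φ, g, hRφ⟩ := R.exists_sum_smul_of_finiteDimensional_range hR
  obtain ⟨e, he⟩ := exists_ne (0 : X)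
  have he' : 0 < ‖e‖ := norm_pos_iff.2 he
  let σ : ℝ := ∑ j, (‖φ j‖ + 1)
  have hσ : 0 ≤ σ := Finset.sum_nonneg fun j _ => by positivity
  let τ : ℝ := ∑ j, ‖g j‖
  have hτ : 0 ≤ τ := Finset.sum_nonneg fun j _ => norm_nonneg _
  obtain ⟨t, ht, hnet⟩ := exists_finset_forall_norm_sub_le g (η := 1 / (σ + 1)) (by positivity)
  -- The tuple (φ_j), viewed as an element of the bidual of X^n.
  let Φ : StrongDual 𝕜 (StrongDual 𝕜 (Fin n → X)) := ∑ j, (φ j).comp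
    ((ContinuousLinearMap.compL 𝕜 X (Fin n → X) 𝕜).flip
      (ContinuousLinearMap.single 𝕜 (fun _ => X) j))
  let A : (Fin n → X →L[𝕜] X) → (Fin n → X) →L[𝕜] X := fun B =>
    ∑ j, (B j).comp (ContinuousLinearMap.proj j)
  have hA : ∀ B x, A B x = ∑ j, B j (x j) := fun B x => by
    simp [A]
  have hΦ : ∀ B (h : StrongDual 𝕜 X), Φ (h.comp (A B)) = ∑ j, φ j (h.comp (B j)) := fun B h => by
    simp only [Φ, sum_apply, ContinuousLinearMap.comp_apply]
    refine Finset.sum_congr rfl fun j _ => congrArg (φ j) ?_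
    ext x
    simp only [ContinuousLinearMap.flip_apply, ContinuousLinearMap.compL_apply,
      ContinuousLinearMap.comp_apply, hA, ContinuousLinearMap.single_apply]
    rw [Finset.sum_eq_single j]
    · simp
    · intro i _ hi
      simp [Pi.single_eq_of_ne hi]
    · simp
  have hΦs : ∀ j (B : X →L[𝕜] X) (h : StrongDual 𝕜 X),
      Φ (h.comp (A (Pi.single j B))) = φ j (h.comp B) := fun j B h => by
    rw [hΦ, Finset.sum_eq_single j]
    · simp
    · intro i _ hi
      simp [Pi.single_eq_of_ne hi]
    · simp
  have hAs : ∀ j (B : X →L[𝕜] X) x, A (Pi.single j B) x = B (x j) := fun j B x => by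
    rw [hA, Finset.sum_eq_single j]
    · simp
    · intro i _ hi
      simp [Pi.single_eq_of_ne hi]
    · simp
  -- Three families of constraints on (x_j): T is bounded on the net, each x_j is bounded, and
  -- f(x_j) is close to φ_j(f). The scalar condition is multiplied by e to take values in X. The
  -- bound ‖R‖ + 2 allows 1 for strictness on the net and 1 for passing from the net to the ball.
  let B : t ⊕ Fin n ⊕ (F × Fin n) → Fin n → X →L[𝕜] X := fun k => match k with
    | .inl y => fun j => g j y • ContinuousLinearMap.id 𝕜 X
    | .inr (.inl j) => Pi.single j (ContinuousLinearMap.id 𝕜 X)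
    | .inr (.inr (f, j)) => Pi.single j ((f : StrongDual 𝕜 X).smulRight e)
  let z : t ⊕ Fin n ⊕ (F × Fin n) → X := fun k => match k with
    | .inl _ => 0
    | .inr (.inl _) => 0
    | .inr (.inr (f, j)) => φ j f • e
  let s : t ⊕ Fin n ⊕ (F × Fin n) → ℝ := fun k => match k with
    | .inl _ => ‖R‖
    | .inr (.inl j) => ‖φ j‖
    | .inr (.inr _) => 0
  let r : t ⊕ Fin n ⊕ (F × Fin n) → ℝ := fun k => match k with
    | .inl _ => ‖R‖ + 1
    | .inr (.inl j) => ‖φ j‖ + 1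
    | .inr (.inr _) => ε / (τ + 1) * ‖e‖
  obtain ⟨x, hx⟩ := exists_norm_sub_lt_of_bidual Φ (fun k => A (B k)) z r s
    (by
      rintro (y | j | ⟨f, j⟩)
      · simp only [r]; positivity
      · simp only [r]; positivity
      · simp only [r]; positivity)
    (by
      rintro (y | j | ⟨f, j⟩)
      · simp only [r, s]; linarith
      · simp only [r, s]; linarith
      · simp only [r, s]; positivity)
    (by
      rintro (y | j | ⟨f, j⟩) h
      · have : Φ (h.comp (A (B (.inl y)))) = R h y := by
          rw [hΦ, hRφ, sum_apply]
          refine Finset.sum_congr rfl fun j _ => ?_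
          simp only [B, ContinuousLinearMap.comp_smul, map_smul, ContinuousLinearMap.comp_id,
            smul_apply, smul_eq_mul]
          ring
        rw [this]
        simp only [z, s, map_zero, sub_zero]
        calc ‖R h y‖ ≤ ‖R h‖ * ‖(y : X)‖ := (R h).le_opNorm _
          _ ≤ ‖R h‖ * 1 := by gcongr; exact ht _ y.2
          _ ≤ ‖R‖ * ‖h‖ := by rw [mul_one]; exact R.le_opNorm h
      · simp only [B, z, s, hΦs, map_zero, sub_zero, ContinuousLinearMap.comp_id]
        exact (φ j).le_opNorm h
      · have : h.comp ((f : StrongDual 𝕜 X).smulRight e) = h e • (f : StrongDual 𝕜 X) := by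
          ext v
          simp [mul_comm]
        simp only [B, z, s, hΦs, this, map_smul, smul_eq_mul, zero_mul]
        rw [mul_comm, sub_self, norm_zero])
  have hx₁ : ∀ y ∈ t, ‖∑ j, g j y • x j‖ ≤ ‖R‖ + 1 := fun y hy => by
    have := (hx (.inl ⟨y, hy⟩)).le
    simpa [B, z, r, hA] using this
  have hx₂ : ∀ j, ‖x j‖ ≤ ‖φ j‖ + 1 := fun j => by
    have := (hx (.inr (.inl j))).le
    simpa [B, z, r, hAs] using this
  have hx₃ : ∀ f ∈ F, ∀ j, ‖f (x j) - φ j f‖ ≤ ε / (τ + 1) := fun f hf j => by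
    have := (hx (.inr (.inr (⟨f, hf⟩, j)))).le
    simp only [B, z, r, hAs, ContinuousLinearMap.smulRight_apply, ← sub_smul, norm_smul] at this
    exact le_of_mul_le_mul_right this he'
  let T : X →L[𝕜] X := ∑ j, (g j).smulRight (x j)
  have hT : ∀ v, T v = ∑ j, g j v • x j := fun v => by simp [T]
  refine ⟨T, sum_mem fun j _ => smulRight_mem_finiteRankOps _ _, ?_, fun f hf => ?_⟩
  · refine ContinuousLinearMap.opNorm_le_of_unit_norm (by positivity) fun v hv => ?_
    obtain ⟨y, hy, hvy⟩ := hnet v hv.le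
    have hsplit : T v = ∑ j, g j y • x j + ∑ j, (g j v - g j y) • x j := by
      rw [hT, ← Finset.sum_add_distrib]
      refine Finset.sum_congr rfl fun j _ => ?_
      rw [← add_smul]
      congr 1
      ring
    have h2 : ‖∑ j, (g j v - g j y) • x j‖ ≤ 1 := by
      calc ‖∑ j, (g j v - g j y) • x j‖ ≤ ∑ j, 1 / (σ + 1) * (‖φ j‖ + 1) := by
            refine norm_sum_le_of_le _ fun j _ => ?_
            rw [norm_smul]
            gcongr
            · exact hvy j
            · exact hx₂ j
        _ = σ / (σ + 1) := by rw [← Finset.mul_sum]; ring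
        _ ≤ 1 := div_le_one_of_le₀ (by linarith) (by positivity)
    rw [hsplit]
    linarith [norm_add_le (∑ j, g j y • x j) (∑ j, (g j v - g j y) • x j), hx₁ y hy]
  · have : f.comp T - R f = ∑ j, (f (x j) - φ j f) • g j := by
      ext v
      simp only [sub_apply, ContinuousLinearMap.comp_apply, hT, hRφ, map_sum,
        map_smul, sum_apply, smul_apply, smul_eq_mul]
      rw [← Finset.sum_sub_distrib]
      refine Finset.sum_congr rfl fun j _ => ?_
      ring
    rw [this]
    calc ‖∑ j, (f (x j) - φ j f) • g j‖ ≤ ∑ j, ε / (τ + 1) * ‖g j‖ := by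
          refine norm_sum_le_of_le _ fun j _ => ?_
          rw [norm_smul]
          gcongr
          exact hx₃ f hf j
      _ = ε * (τ / (τ + 1)) := by rw [← Finset.mul_sum]; ring
      _ ≤ ε * 1 := by
          gcongr
          exact div_le_one_of_le₀ (by linarith) (by positivity)
      _ = ε := mul_one ε

end

/-! ### Reconstruction implies separability and bounded approximation -/

theorem ContinuousLinearMap.exists_norm_le_of_tendsto {𝕜 E F : Type*} [RCLike 𝕜]
    [NormedAddCommGroup E] [NormedSpace 𝕜 E] [CompleteSpace E] [NormedAddCommGroup F]
    [NormedSpace 𝕜 F] {P : ℕ → E →L[𝕜] F} {Q : E → F}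
    (hP : ∀ v, Tendsto (fun n => P n v) atTop (𝓝 (Q v))) : ∃ C, ∀ n, ‖P n‖ ≤ C := by
  refine banach_steinhaus fun v => ?_
  obtain ⟨C, hC⟩ := (Metric.isBounded_range_of_tendsto _ (hP v)).exists_norm_le
  exact ⟨C, fun n => hC _ ⟨n, rfl⟩⟩

section

variable {𝕜 E : Type*} [RCLike 𝕜] [NormedAddCommGroup E] [NormedSpace 𝕜 E]

/-- Uniformly bounded operators converging pointwise to the identity are eventually uniformly
close to it on a compact set. -/
theorem ContinuousLinearMap.exists_forall_norm_sub_le_of_isCompact {P : ℕ → E →L[𝕜] E} {C : ℝ}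
    (hC : ∀ n, ‖P n‖ ≤ C) (hP : ∀ v, Tendsto (fun n => P n v) atTop (𝓝 v)) {K : Set E}
    (hK : IsCompact K) {ε : ℝ} (hε : 0 < ε) : ∃ n, ∀ v ∈ K, ‖v - P n v‖ ≤ ε := by
  have hC0 : 0 ≤ C := (norm_nonneg _).trans (hC 0)
  obtain ⟨t, -, ht, hcov⟩ := hK.finite_cover_balls (e := ε / (C + 2)) (by positivity)
  have hev : ∀ᶠ n in atTop, ∀ y ∈ t, ‖P n y - y‖ ≤ ε / (C + 2) := by
    rw [Filter.eventually_all_finite ht]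
    intro y _
    exact ((tendsto_iff_norm_sub_tendsto_zero.1 (hP y)).eventually_le_const (by positivity))
  obtain ⟨n, hn⟩ := hev.exists
  refine ⟨n, fun v hv => ?_⟩
  have hv' := hcov hv
  simp only [Set.mem_iUnion, Metric.mem_ball, dist_eq_norm] at hv'
  obtain ⟨y, hy, hvy⟩ := hv'
  have hsplit : v - P n v = (v - y) - P n (v - y) - (P n y - y) := by
    rw [map_sub]
    abel
  have h1 : ‖P n (v - y)‖ ≤ C * (ε / (C + 2)) := (P n).le_of_opNorm_le_of_le (hC n) hvy.le
  rw [hsplit]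
  calc ‖(v - y) - P n (v - y) - (P n y - y)‖ ≤ ‖v - y‖ + ‖P n (v - y)‖ + ‖P n y - y‖ :=
        (norm_sub_le _ _).trans (by gcongr; exact norm_sub_le _ _)
    _ ≤ ε / (C + 2) + C * (ε / (C + 2)) + ε / (C + 2) := by
        gcongr
        exact hn y hy
    _ = ε := by field_simp; ring

variable {x : ℕ → E} {f : ℕ → StrongDual 𝕜 E}

theorem Reconstructs.separableSpace (h : Reconstructs 𝕜 x f) :
    TopologicalSpace.SeparableSpace E := by
  have hsep : TopologicalSpace.IsSeparable
      (closure (Submodule.span 𝕜 (Set.range x) : Set E)) :=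
    (Set.countable_range x).isSeparable.span (R := 𝕜) |>.closure
  rw [← TopologicalSpace.isSeparable_univ_iff]
  refine hsep.mono fun v _ => mem_closure_of_tendsto (h v) (Eventually.of_forall fun n => ?_)
  exact sum_mem fun i _ => Submodule.smul_mem _ _ (Submodule.subset_span ⟨i, rfl⟩)

theorem Reconstructs.hasBAP [CompleteSpace E] (h : Reconstructs 𝕜 x f) : HasBAP 𝕜 E := by
  let P : ℕ → E →L[𝕜] E := fun n => ∑ i ∈ Finset.range n, (f i).smulRight (x i)
  have hPv : ∀ n v, P n v = ∑ i ∈ Finset.range n, f i v • x i := fun n v => by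
    simp [P]
  have hP : ∀ v, Tendsto (fun n => P n v) atTop (𝓝 v) := fun v => by
    simpa only [hPv] using h v
  obtain ⟨C, hC⟩ := ContinuousLinearMap.exists_norm_le_of_tendsto hP
  refine ⟨C, fun K hK ε hε => ?_⟩
  obtain ⟨n, hn⟩ := ContinuousLinearMap.exists_forall_norm_sub_le_of_isCompact hC hP hK hε
  refine ⟨P n, ?_, hC n, hn⟩
  classical
  let W : Submodule 𝕜 E := Submodule.span 𝕜 ((Finset.range n).image x : Finset E)
  have hle : LinearMap.range (P n : E →ₗ[𝕜] E) ≤ W := by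
    rintro _ ⟨v, rfl⟩
    rw [ContinuousLinearMap.coe_coe, hPv]
    exact sum_mem fun i hi => W.smul_mem _
      (Submodule.subset_span (Finset.mem_coe.2 (Finset.mem_image_of_mem x hi)))
  exact Submodule.finiteDimensional_of_le hle

end

/-! ### Approximating both X and its dual -/

section

variable {𝕜 X : Type*} [RCLike 𝕜] [NormedAddCommGroup X] [NormedSpace 𝕜 X]

/-- A normed space is separable when its dual is. -/
theorem separableSpace_of_strongDual [TopologicalSpace.SeparableSpace (StrongDual 𝕜 X)] :
    TopologicalSpace.SeparableSpace X := by
  let d := TopologicalSpace.denseSeq (StrongDual 𝕜 X)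
  have hx : ∀ n, ∃ x : X, ‖x‖ ≤ 1 ∧ ‖d n‖ / 2 ≤ ‖d n x‖ := fun n => by
    obtain ⟨w, hw, hw'⟩ := (d n).exists_norm_lt_le_re (s := 1 / 2) one_pos (by norm_num)
    exact ⟨w, hw.le, by linarith [RCLike.re_le_norm (d n w)]⟩
  choose x hx hdx using hx
  let M : Submodule 𝕜 X := (Submodule.span 𝕜 (Set.range x)).topologicalClosure
  have hM : M = ⊤ := by
    by_contra hne
    obtain ⟨v, -, hv⟩ := SetLike.exists_of_lt (lt_top_iff_ne_top.2 hne)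
    let _ : NormedSpace ℝ X := NormedSpace.restrictScalars ℝ 𝕜 X
    have : IsScalarTower ℝ 𝕜 X := RestrictScalars.isScalarTower ℝ 𝕜 X
    obtain ⟨f, u, hfv, hfM⟩ := RCLike.geometric_hahn_banach_point_closed (𝕜 := 𝕜)
      (M.restrictScalars ℝ).convex (Submodule.isClosed_topologicalClosure _) hv
    have hf0 : ∀ y ∈ M, f y = 0 := fun y hy =>
      StrongDual.eq_zero_of_forall_le_re f (fun y hy => (hfM y hy).le) hy
    have hf : f ≠ 0 := by
      rintro rfl
      have := hfM 0 M.zero_mem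
      simp only [zero_apply, map_zero] at hfv this
      linarith
    have hpos : 0 < ‖f‖ := norm_pos_iff.2 hf
    -- Since f kills x_n, ‖d_n‖ / 2 ≤ ‖d_n - f‖ < ‖f‖ / 4, whereas ‖d_n‖ > 3‖f‖ / 4.
    obtain ⟨n, hn⟩ := (TopologicalSpace.denseRange_denseSeq (StrongDual 𝕜 X)).exists_dist_lt f
      (show 0 < ‖f‖ / 4 by positivity)
    rw [dist_eq_norm, norm_sub_rev] at hn
    have h1 : ‖d n (x n)‖ ≤ ‖d n - f‖ := by
      have h0 : (d n - f) (x n) = d n (x n) := by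
        rw [sub_apply, hf0 _ (Submodule.le_topologicalClosure _ (Submodule.subset_span ⟨n, rfl⟩)),
          sub_zero]
      rw [← h0]
      exact (d n - f).unit_le_opNorm _ (hx n)
    have h2 : ‖f‖ ≤ ‖d n‖ + ‖d n - f‖ := by
      rw [norm_sub_rev]
      simpa using norm_add_le (d n) (f - d n)
    have := hdx n
    change ‖d n - f‖ < ‖f‖ / 4 at hn
    linarith
  have hsep := ((Set.countable_range x).isSeparable.span (R := 𝕜)).closure
  rw [← TopologicalSpace.isSeparable_univ_iff]
  refine hsep.mono fun v _ => ?_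
  have : v ∈ M := hM ▸ Submodule.mem_top
  exact this

/-- If finite rank operators of norm at most `C` have adjoints approximating the identity on finite
sets, then convex combinations also approximate the identity on finite sets. -/
theorem exists_finiteRankOps_norm_sub_le {C : ℝ}
    (H : ∀ (F : Finset (StrongDual 𝕜 X)) (ε : ℝ), 0 < ε →
      ∃ T ∈ finiteRankOps 𝕜 X, ‖T‖ ≤ C ∧ ∀ f ∈ F, ‖f.comp T - f‖ ≤ ε)
    (F : Finset (StrongDual 𝕜 X)) (G : Finset X) {ε : ℝ} (hε : 0 < ε) :
    ∃ T ∈ finiteRankOps 𝕜 X, ‖T‖ ≤ C ∧ (∀ f ∈ F, ‖f.comp T - f‖ ≤ ε) ∧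
      ∀ x ∈ G, ‖T x - x‖ ≤ ε := by
  classical
  by_contra! hcon
  let _ : NormedSpace ℝ X := NormedSpace.restrictScalars ℝ 𝕜 X
  have : IsScalarTower ℝ 𝕜 X := RestrictScalars.isScalarTower ℝ 𝕜 X
  let D : Set (X →L[𝕜] X) :=
    {T | T ∈ finiteRankOps 𝕜 X ∧ ‖T‖ ≤ C ∧ ∀ f ∈ F, ‖f.comp T - f‖ ≤ ε}
  have hD : Convex ℝ D := by
    rintro T₁ ⟨h₁, hC₁, hF₁⟩ T₂ ⟨h₂, hC₂, hF₂⟩ a b ha hb hab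
    have hsm : ∀ (c : ℝ) (T : X →L[𝕜] X), c • T = (c : 𝕜) • T := fun c T => by
      ext v
      exact RCLike.real_smul_eq_coe_smul c (T v)
    refine ⟨?_, ?_, fun f hf => ?_⟩
    · rw [hsm, hsm]
      exact add_mem (Submodule.smul_mem _ _ h₁) (Submodule.smul_mem _ _ h₂)
    · simpa using convex_closedBall (0 : X →L[𝕜] X) C (by simpa using hC₁) (by simpa using hC₂)
        ha hb hab
    · have hab' : (a : 𝕜) + (b : 𝕜) = 1 := by rw [← RCLike.ofReal_add, hab, RCLike.ofReal_one]
      have : f.comp (a • T₁ + b • T₂) - f =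
          (a : 𝕜) • (f.comp T₁ - f) + (b : 𝕜) • (f.comp T₂ - f) := by
        rw [hsm, hsm]
        ext v
        simp only [sub_apply, add_apply, smul_apply, ContinuousLinearMap.comp_apply, map_add,
          map_smul, smul_eq_mul]
        linear_combination f v * hab'
      rw [this]
      calc _ ≤ a * ε + b * ε := by
            refine (norm_add_le _ _).trans ?_
            rw [norm_smul, norm_smul, RCLike.norm_ofReal, RCLike.norm_ofReal, abs_of_nonneg ha,
              abs_of_nonneg hb]
            gcongr
            · exact hF₁ f hf
            · exact hF₂ f hf
        _ = ε := by rw [← add_mul, hab, one_mul]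
  let L : (X →L[𝕜] X) →L[𝕜] (G → X) :=
    ContinuousLinearMap.pi fun x : G => ContinuousLinearMap.apply 𝕜 X (x : X)
  let U : Set (G → X) := Set.univ.pi fun x : G => Metric.ball (x : X) ε
  have hUc : Convex ℝ U := convex_pi fun k _ => convex_ball _ _
  have hUo : IsOpen U := isOpen_set_pi Set.finite_univ fun k _ => Metric.isOpen_ball
  have hVc : Convex ℝ (L '' D) := hD.is_linear_image
    ⟨fun x y => map_add L x y, fun c x => by ext y; rfl⟩
  have hdisj : Disjoint U (L '' D) := by
    rw [Set.disjoint_left]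
    rintro _ hU ⟨T, ⟨h₁, h₂, h₃⟩, rfl⟩
    obtain ⟨x, hx, hlt⟩ := hcon T h₁ h₂ h₃
    have := hU ⟨x, hx⟩ (Set.mem_univ _)
    rw [Metric.mem_ball, dist_eq_norm] at this
    exact lt_asymm hlt this
  obtain ⟨Λ, u, hΛU, hΛV⟩ := RCLike.geometric_hahn_banach_open (𝕜 := 𝕜) hUc hUo hVc hdisj
  let h : G → StrongDual 𝕜 X := fun k => Λ.comp (ContinuousLinearMap.single 𝕜 (fun _ => X) k)
  have hΛ : ∀ v, Λ v = ∑ k, h k (v k) := fun v =>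
    (ContinuousLinearMap.sum_comp_single 𝕜 (fun _ : G => X) Λ v).symm
  let p : G → X := fun x => x
  have hp : RCLike.re (Λ p) < u := hΛU _ fun k _ => by simpa [p] using hε
  let σ : ℝ := ∑ x : G, ‖(x : X)‖
  have hσ : 0 ≤ σ := Finset.sum_nonneg fun x _ => norm_nonneg _
  let γ : ℝ := (u - RCLike.re (Λ p)) / (σ + 1)
  have hγ : 0 < γ := div_pos (by linarith) (by positivity)
  -- Adding the components of `Λ` to F forces Λ(L T) within γσ of Λ(p), less than the gap u - re
  -- Λ(p), although T lies in `D`.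
  obtain ⟨T, hT, hTC, hTF⟩ := H (F ∪ Finset.univ.image h) (min ε γ) (lt_min hε hγ)
  have h1 : u ≤ RCLike.re (Λ (L T)) := hΛV _ ⟨T, ⟨hT, hTC, fun f hf =>
    (hTF f (Finset.mem_union_left _ hf)).trans (min_le_left _ _)⟩, rfl⟩
  have h2 : Λ (L T) - Λ p = ∑ x : G, ((h x).comp T - h x) (x : X) := by
    simp only [hΛ, ← Finset.sum_sub_distrib]
    rfl
  have h3 : ‖Λ (L T) - Λ p‖ ≤ γ * σ := by
    rw [h2, Finset.mul_sum]
    refine norm_sum_le_of_le _ fun x _ => ?_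
    exact ContinuousLinearMap.le_of_opNorm_le _ ((hTF (h x) (Finset.mem_union_right _
      (Finset.mem_image_of_mem h (Finset.mem_univ x)))).trans (min_le_right _ _)) _
  have h4 := RCLike.re_le_norm (Λ (L T) - Λ p)
  have h5 : γ * (σ + 1) = u - RCLike.re (Λ p) := div_mul_cancel₀ _ (by positivity)
  rw [map_sub] at h4
  linarith

theorem ContinuousLinearMap.tendsto_of_denseRange {E : Type*} [NormedAddCommGroup E]
    [NormedSpace 𝕜 E] {P : ℕ → E →L[𝕜] E} {C : ℝ} (hC : ∀ n, ‖P n‖ ≤ C) {d : ℕ → E}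
    (hd : DenseRange d) (hP : ∀ i, Tendsto (fun n => P n (d i)) atTop (𝓝 (d i))) (v : E) :
    Tendsto (fun n => P n v) atTop (𝓝 v) := by
  have hC0 : 0 ≤ C := (norm_nonneg _).trans (hC 0)
  rw [Metric.tendsto_atTop]
  intro ε hε
  obtain ⟨i, hi⟩ := hd.exists_dist_lt v (show 0 < ε / (C + 2) by positivity)
  obtain ⟨N, hN⟩ := Metric.tendsto_atTop.1 (hP i) (ε / (C + 2)) (by positivity)
  refine ⟨N, fun n hn => ?_⟩
  have h1 := hN n hn
  rw [dist_eq_norm] at hi h1 ⊢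
  have hsplit : P n v - v = P n (v - d i) + (P n (d i) - d i) - (v - d i) := by
    rw [map_sub]
    abel
  have h2 : ‖P n (v - d i)‖ ≤ C * (ε / (C + 2)) := (P n).le_of_opNorm_le_of_le (hC n) hi.le
  rw [hsplit]
  calc _ ≤ ‖P n (v - d i)‖ + ‖P n (d i) - d i‖ + ‖v - d i‖ :=
        (norm_sub_le _ _).trans (by gcongr; exact norm_add_le _ _)
    _ < C * (ε / (C + 2)) + ε / (C + 2) + ε / (C + 2) := by linarith
    _ = ε := by field_simp; ring

/-- If the dual is separable with the bounded approximation property, finite rank operators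
converge strongly to the identity together with their adjoints. -/
theorem HasBAP.exists_seq_finiteRankOps [Nontrivial X]
    [TopologicalSpace.SeparableSpace (StrongDual 𝕜 X)] (hBAP : HasBAP 𝕜 (StrongDual 𝕜 X)) :
    ∃ S : ℕ → X →L[𝕜] X, (∀ n, S n ∈ finiteRankOps 𝕜 X) ∧
      (∀ x, Tendsto (fun n => S n x) atTop (𝓝 x)) ∧
      ∀ f : StrongDual 𝕜 X, Tendsto (fun n => f.comp (S n)) atTop (𝓝 f) := by
  classical
  obtain ⟨c, hc⟩ := hBAP
  have H : ∀ (F : Finset (StrongDual 𝕜 X)) (ε : ℝ), 0 < ε →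
      ∃ T ∈ finiteRankOps 𝕜 X, ‖T‖ ≤ c + 2 ∧ ∀ f ∈ F, ‖f.comp T - f‖ ≤ ε := fun F ε hε => by
    obtain ⟨R, hR, hRc, hRF⟩ := hc F F.finite_toSet.isCompact (ε / 2) (by positivity)
    obtain ⟨T, hT, hTR, hTF⟩ := exists_finiteRankOps_comp_sub_le R hR F
      (show 0 < ε / 2 by positivity)
    refine ⟨T, hT, by linarith, fun f hf => ?_⟩
    have h1 := hRF f hf
    rw [norm_sub_rev] at h1
    linarith [norm_sub_le_norm_sub_add_norm_sub (f.comp T) (R f) f, hTF f hf]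
  have := separableSpace_of_strongDual (𝕜 := 𝕜) (X := X)
  let d := TopologicalSpace.denseSeq (StrongDual 𝕜 X)
  let e := TopologicalSpace.denseSeq X
  -- Stage n handles the first n terms of both dense sequences; the uniform bound c + 2 extends the
  -- convergence to all vectors and functionals.
  choose S hS hSC hSd hSe using fun n : ℕ => exists_finiteRankOps_norm_sub_le H
    ((Finset.range n).image d) ((Finset.range n).image e)
    (show (0 : ℝ) < 1 / ((n : ℝ) + 1) by positivity)
  refine ⟨S, hS, ?_, ?_⟩
  · refine ContinuousLinearMap.tendsto_of_denseRange hSC (TopologicalSpace.denseRange_denseSeq X)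
      fun i => ?_
    rw [tendsto_iff_norm_sub_tendsto_zero]
    refine squeeze_zero' (Eventually.of_forall fun _ => norm_nonneg _) ?_
      tendsto_one_div_add_atTop_nhds_zero_nat
    filter_upwards [eventually_gt_atTop i] with n hn
    exact hSe n _ (Finset.mem_image_of_mem e (Finset.mem_range.2 hn))
  · let P : ℕ → StrongDual 𝕜 X →L[𝕜] StrongDual 𝕜 X := fun n =>
      (ContinuousLinearMap.compL 𝕜 X X 𝕜).flip (S n)
    have hP : ∀ n, ‖P n‖ ≤ c + 2 := fun n => by
      refine ContinuousLinearMap.opNorm_le_bound _ ((norm_nonneg _).trans (hSC 0)) fun f => ?_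
      calc ‖f.comp (S n)‖ ≤ ‖f‖ * ‖S n‖ := f.opNorm_comp_le _
        _ ≤ ‖f‖ * (c + 2) := by gcongr; exact hSC n
        _ = (c + 2) * ‖f‖ := mul_comm _ _
    refine ContinuousLinearMap.tendsto_of_denseRange (P := P) hP
      (TopologicalSpace.denseRange_denseSeq (StrongDual 𝕜 X)) fun i => ?_
    rw [tendsto_iff_norm_sub_tendsto_zero]
    refine squeeze_zero' (Eventually.of_forall fun _ => norm_nonneg _) ?_
      tendsto_one_div_add_atTop_nhds_zero_nat
    filter_upwards [eventually_gt_atTop i] with n hn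
    exact hSd n _ (Finset.mem_image_of_mem d (Finset.mem_range.2 hn))

/-- Finite rank operators converging strongly to the identity together with their adjoints yield a
shrinking Schauder frame. -/
theorem exists_isShrinkingSchauderFrame [Nontrivial X] {S : ℕ → X →L[𝕜] X}
    (hS : ∀ n, S n ∈ finiteRankOps 𝕜 X) (hSx : ∀ x, Tendsto (fun n => S n x) atTop (𝓝 x))
    (hSf : ∀ f : StrongDual 𝕜 X, Tendsto (fun n => f.comp (S n)) atTop (𝓝 f)) :
    ∃ (x : ℕ → X) (f : ℕ → StrongDual 𝕜 X), IsShrinkingSchauderFrame 𝕜 x f := by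
  -- Shifted to start at 0, the value of the empty partial sum.
  let S' : ℕ → X →L[𝕜] X := fun n => n.casesOn 0 S
  have hS' : ∀ n, S' n ∈ finiteRankOps 𝕜 X := fun n => by
    cases n with
    | zero => exact zero_mem _
    | succ n => exact hS n
  obtain ⟨u, hu₀, hu⟩ := exists_seq_rankOneOp_interpolating rfl hS'
  refine ⟨fun i => (u i).1, fun i => (u i).2, ⟨hu₀, fun v => ?_⟩, fun g => ?_⟩
  · have := tendsto_of_interpolating hu (ContinuousLinearMap.apply 𝕜 X v)
      ((tendsto_add_atTop_iff_nat 1).1 (hSx v))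
    simpa [rankOneOp] using this
  · have := tendsto_of_interpolating hu (ContinuousLinearMap.compL 𝕜 X X 𝕜 g)
      ((tendsto_add_atTop_iff_nat 1).1 (hSf g))
    refine this.congr fun k => ?_
    rw [map_sum]
    refine Finset.sum_congr rfl fun i _ => ?_
    ext v
    simp [rankOneOp, mul_comm]

end

theorem theorem5p3 (𝕜 : Type*) [RCLike 𝕜] (X : Type*) [NormedAddCommGroup X] [NormedSpace 𝕜 X]
    [CompleteSpace X] [Nontrivial X] :
    (∃ (x : ℕ → X) (f : ℕ → StrongDual 𝕜 X), IsShrinkingSchauderFrame 𝕜 x f) ↔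
      TopologicalSpace.SeparableSpace (StrongDual 𝕜 X) ∧ HasBAP 𝕜 (StrongDual 𝕜 X) := by
  constructor
  · rintro ⟨x, f, h⟩
    exact ⟨h.reconstructs_dual.separableSpace, h.reconstructs_dual.hasBAP⟩
  · rintro ⟨_, hBAP⟩
    obtain ⟨S, hS, hSx, hSf⟩ := hBAP.exists_seq_finiteRankOps
    exact exists_isShrinkingSchauderFrame hS hSx hSf
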